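/- Let $n\ge 1$ and let $q$ be a prime power. For $\mathbf x,\mathbf y\in\mathbb F_q^n$, with coordinates indexed by $\mathbb Z/n\mathbb Z$, the symbol-pair distance is $d_p(\mathbf x,\mathbf y)=|\{i\in\mathbb Z/n\mathbb Z : (x_i,x_{i+1})\ne(y_i,y_{i+1})\}|$. The minimum symbol-pair distance of a code $\mathcal C\subseteq\mathbb F_q^n$ is the minimum of $d_p(\mathbf x,\mathbf y)$ over distinct $\mathbf x,\mathbf y\in\mathcal C$. For $2\le d\le n$, an MDS $(n,d)_q$ symbol-pair code is a code $\mathcal C\subseteq\mathbb F_q^n$ with minimum symbol-pair distance $d$ that attains the symbol-pair Singleton bound $|\mathcal C|\le q^{n-d+2}$, i.e. $|\mathcal C|=q^{n-d+2}$. An $[n,k,d]$ code is a linear code of length $n$, dimension $k$ and minimum Hamming distance $d$. Words $\mathbf c\in\mathbb F_q^n$ are identified with polynomials $c(x)=\sum_{i=0}^{n-1}c_ix^i$. A linear code $\mathcal C$ of length $n$ that is closed under cyclic shifts has generator polynomial $g(x)$ if $g$ is monic, $g\mid x^n-1$ and $\mathcal C=\{f(x)g(x)\bmod (x^n-1) :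 f\in\mathbb F_q[x]\}$. **Theorem.** Let $p$ be an odd prime with $3\mid(p-1)$. For every primitive cube root of unity $\omega\in\mathbb F_p$, the polynomial $$g(x)=(x-1)^4(x-\omega)^2(x-\omega^2)^2$$ is the generator polynomial of a (repeated-root) cyclic code $\mathcal C$ of length $3p$ over $\mathbb F_p$; this code $\mathcal C$ is a $[3p,\,3p-8,\,5]$ code with minimum symbol-pair distance $10$, and it is an MDS $(3p,10)_p$ symbol-pair code. In particular, there exists an MDS $(3p,10)_p$ symbol-pair code. -/

import Mathlib

open Polynomial

namespace SymbolPair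

/-- Words of length `n` over `F`, with coordinates indexed by the residue class ring `ℤ/nℤ`
(so that subscripts are taken modulo `n`). -/
abbrev Word (n : ℕ) (F : Type*) := ZMod n → F

section PairMetric

variable {n : ℕ} {F : Type*}

/-- The symbol-pair read vector `((x₀, x₁), (x₁, x₂), …, (xₙ₋₁, x₀))`. -/
def pairRead (x : Word n F) : Word n (F × F) := fun i => (x i, x (i + 1))

/-- The symbol-pair distance `|{i ∈ ℤ/nℤ | (xᵢ, xᵢ₊₁) ≠ (yᵢ, yᵢ₊₁)}|`. -/
def pairDist [NeZero n] [DecidableEq F] (x y : Word n F) : ℕ :=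
  hammingDist (pairRead x) (pairRead y)

/-- `d` is the minimum Hamming distance between distinct codewords of `C`. -/
def HasMinHammingDist [NeZero n] [DecidableEq F] (C : Set (Word n F)) (d : ℕ) : Prop :=
  IsLeast {m : ℕ | ∃ x ∈ C, ∃ y ∈ C, x ≠ y ∧ m = hammingDist x y} d

/-- `d` is the minimum symbol-pair distance between distinct codewords of `C`. -/
def HasMinPairDist [NeZero n] [DecidableEq F] (C : Set (Word n F)) (d : ℕ) : Prop :=
  IsLeast {m : ℕ | ∃ x ∈ C, ∃ y ∈ C, x ≠ y ∧ m = pairDist x y} d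

/-- `C` is an MDS `(n, d)_q` symbol-pair code, `q = |F|`: it has length `n`, minimum symbol-pair
distance `d` with `2 ≤ d ≤ n`, and its size attains the symbol-pair Singleton bound
`|C| ≤ q ^ (n - d + 2)`. -/
structure IsMDSPairCode [NeZero n] [DecidableEq F] (C : Set (Word n F)) (d : ℕ) : Prop where
  two_le : 2 ≤ d
  le_length : d ≤ n
  minPairDist : HasMinPairDist C d
  card_eq : C.ncard = Nat.card F ^ (n - d + 2)

end PairMetric

section Linear

variable {n : ℕ} {F : Type*} [Field F]

/-- `C` is an `[n, k, d]` linear code over `F` (`d` is the minimum Hamming distance). -/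
def IsLinearCode [NeZero n] [DecidableEq F] (C : Submodule F (Word n F)) (k d : ℕ) : Prop :=
  Module.finrank F C = k ∧ HasMinHammingDist (C : Set (Word n F)) d

/-- `C` is cyclic: it is closed under `(x₀, …, xₙ₋₁) ↦ (xₙ₋₁, x₀, …, xₙ₋₂)`. -/
def IsCyclicCode (C : Submodule F (Word n F)) : Prop :=
  ∀ c ∈ C, (fun i => c (i - 1)) ∈ C

/-- The polynomial `c₀ + c₁ x + ⋯ + cₙ₋₁ xⁿ⁻¹` of a word `c`. -/
noncomputable def toPoly [NeZero n] (c : Word n F) : F[X] :=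
  ∑ i : ZMod n, C (c i) * X ^ i.val

/-- The code `⟨g(x)⟩ = {f(x) g(x) mod (xⁿ - 1) | f(x) ∈ F[x]}` of length `n`. -/
noncomputable def cyclicCode (n : ℕ) [NeZero n] (g : F[X]) : Submodule F (Word n F) where
  carrier := {c | ∃ f : F[X], toPoly c = (f * g) %ₘ (X ^ n - 1)}
  zero_mem' := ⟨0, by simp [toPoly]⟩
  add_mem' := by
    rintro a b ⟨f, hf⟩ ⟨h, hh⟩
    refine ⟨f + h, ?_⟩
    rw [add_mul, add_modByMonic, ← hf, ← hh]
    simp [toPoly, add_mul, Finset.sum_add_distrib]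
  smul_mem' := by
    rintro r a ⟨f, hf⟩
    refine ⟨r • f, ?_⟩
    rw [smul_mul_assoc, smul_modByMonic, ← hf]
    simp [toPoly, Finset.smul_sum, smul_eq_C_mul, mul_assoc]

/-- `g` is the generator polynomial of the cyclic code `D` of length `n`:
`g` is monic, `g ∣ xⁿ - 1`, and `D = ⟨g(x)⟩`. -/
structure IsGeneratorPolynomial [NeZero n] (g : F[X]) (D : Submodule F (Word n F)) : Prop where
  cyclic : IsCyclicCode D
  monic : g.Monic
  dvd : g ∣ X ^ n - 1
  eq_span : D = cyclicCode n g

end Linear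

end SymbolPair

/-!
Write a codeword as `c = ∑ cᵢ xⁱ`, `i ∈ ℤ/3p`, and split the index `i` into its residues modulo `3`
and modulo `p`. Since `X * d/dX` multiplies `cᵢ` by `i`, divisibility of `c` by `(x - a)ᵐ` forces
`∑ cᵢ iᵏ aⁱ = 0` in `𝔽_p` for `k < m`. For `a = 1, ω, ω²` the factor `aⁱ` only sees `i mod 3`, so
inverting this `3 × 3` Vandermonde system shows that on each class modulo `3` the moments
`∑ cᵢ iᵏ`, `k = 0, 1`, vanish (`moment_eq_zero_of_dvd`), while the moments with `k = 2, 3` vanish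
after summing over the three classes (`sum_pow_mul_moment` with `a = 1`).

On a single class the residues modulo `p` are pairwise distinct, so `m` vanishing moments force more
than `m` support points (`lt_card_classSupport`). Let `S` be the support of `c ≠ 0`, `Sᵣ` its part in
the class `r`, and `T = S ∪ (S - 1)`, whose size is the pair weight.

* If only one class is met, four moments vanish on it, so `|S| ≥ 5`, and `S`, `S - 1` are disjoint.
* If exactly the classes `r` and `r + 1` are met, then
  `|T| = |Sᵣ| + |Sᵣ ∪ (Sᵣ₊₁ - 1)| + |Sᵣ₊₁| ≥ 9`, with equality only if `Sᵣ₊₁ = Sᵣ + 1` has three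
  elements. For three points with vanishing moments `0, 1`, the third moment is the second times
  the sum of the points; the sums for `Sᵣ` and `Sᵣ + 1` differ by `3 ≠ 0`, so the second moments
  vanish too, which three support points do not allow (`classSupport_ne_shift`).
* If all classes are met, then `|S| ≥ 9`, and `|T| = 9` would give `S = S - 1`, hence `S = ℤ/3p`.

So the pair distance is at least `10` (`ten_le_pairDist`). The pair distance is at most twice the
Hamming distance, so the latter is at least `5`; the codeword `(x³ - 1)⁴`, of weight at most `5`,
shows that both bounds are attained. The dimension is `3p - deg g = 3p - 8`.
-/

namespace SymbolPair

/-! ### Sparse families with vanishing power moments -/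

/-- A nonempty family of nonzero coefficients at distinct nodes whose first `m` power moments vanish
has more than `m` members: otherwise the polynomial vanishing at all nodes but one has degree below
`m`, and pairing with it isolates a single coefficient. -/
theorem lt_card_of_moments_eq_zero {ι F : Type*} [Field F] {S : Finset ι} {x c : ι → F} {m : ℕ}
    (hx : Set.InjOn x S) (hc : ∀ i ∈ S, c i ≠ 0) (hS : S.Nonempty)
    (hm : ∀ k < m, ∑ i ∈ S, c i * x i ^ k = 0) : m < S.card := by
  classical
  by_contra! hle
  obtain ⟨j, hj⟩ := hS
  set f : F[X] := ∏ i ∈ S.erase j, (X - C (x i)) with hf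
  have hdeg : f.natDegree < m := by
    have := Finset.card_erase_lt_of_mem hj
    simp only [hf, natDegree_finsetProd_X_sub_C_eq_card]
    omega
  have hsum : ∑ i ∈ S, c i * f.eval (x i) = 0 := by
    simp_rw [eval_eq_sum_range' hdeg, Finset.mul_sum]
    rw [Finset.sum_comm]
    refine Finset.sum_eq_zero fun k hk => ?_
    rw [← mul_zero (f.coeff k), ← hm k (Finset.mem_range.1 hk), Finset.mul_sum]
    exact Finset.sum_congr rfl fun i _ => by ring
  rw [Finset.sum_eq_single_of_mem j hj] at hsum
  · refine (mul_ne_zero (hc j hj) ?_) hsum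
    rw [hf, eval_prod, Finset.prod_ne_zero_iff]
    intro i hi
    rw [Finset.mem_erase] at hi
    simpa [sub_eq_zero] using fun h => hi.1 (hx hj hi.2 h).symm
  · intro i hi hij
    rw [hf, eval_prod, Finset.prod_eq_zero (Finset.mem_erase.2 ⟨hij, hi⟩) (by simp), mul_zero]

/-- Obtained by pairing the coefficients with the monic cubic whose roots are the three nodes. -/
theorem sum_mul_pow_three_of_card_eq_three {ι F : Type*} [Field F] {S : Finset ι} {x c : ι → F}
    (hS : S.card = 3) (h0 : ∑ i ∈ S, c i * x i ^ 0 = 0) (h1 : ∑ i ∈ S, c i * x i ^ 1 = 0) :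
    ∑ i ∈ S, c i * x i ^ 3 = (∑ i ∈ S, x i) * ∑ i ∈ S, c i * x i ^ 2 := by
  classical
  obtain ⟨a, b, d, hab, had, hbd, rfl⟩ := Finset.card_eq_three.1 hS
  simp only [Finset.sum_insert, Finset.mem_insert, Finset.mem_singleton, hab, had, hbd, or_self,
    not_false_eq_true, Finset.sum_singleton] at *
  linear_combination (x a * x b * x d) * h0 - (x a * x b + x a * x d + x b * x d) * h1

/-! ### Cyclic codes as polynomials -/

section Poly
variable {n : ℕ} [NeZero n] {F : Type*} [Field F]

theorem coeff_toPoly (c : Word n F) (k : ℕ) :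
    (toPoly c).coeff k = if k < n then c k else 0 := by
  rw [toPoly, finsetSum_coeff]
  simp only [coeff_C_mul_X_pow]
  split_ifs with hk
  · rw [Finset.sum_eq_single (k : ZMod n)]
    · simp [ZMod.val_cast_of_lt hk]
    · rintro i - hi
      rw [if_neg]
      rintro rfl
      exact hi (by simp)
    · simp
  · exact Finset.sum_eq_zero fun i _ => if_neg fun h => hk (by rw [h]; exact i.val_lt)

theorem degree_toPoly_lt (c : Word n F) : (toPoly c).degree < n := by
  rw [degree_lt_iff_coeff_zero]
  intro k hk
  rw [coeff_toPoly, if_neg (by omega)]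

theorem toPoly_coeff {P : F[X]} (hP : P.degree < n) :
    toPoly (fun i : ZMod n => P.coeff i.val) = P := by
  ext k
  rw [coeff_toPoly]
  split_ifs with hk
  · rw [ZMod.val_cast_of_lt hk]
  · exact (coeff_eq_zero_of_degree_lt (hP.trans_le (by exact_mod_cast not_lt.1 hk))).symm

theorem toPoly_injective : Function.Injective (toPoly : Word n F → F[X]) := by
  intro a b h
  ext i
  have := congrArg (fun P => coeff P i.val) h
  simpa [coeff_toPoly, i.val_lt] using this

theorem mem_cyclicCode {g : F[X]} (hg : g ∣ X ^ n - 1) {c : Word n F} :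
    c ∈ cyclicCode n g ↔ g ∣ toPoly c := by
  have hmon : (X ^ n - 1 : F[X]).Monic := monic_X_pow_sub_C 1 (NeZero.ne n)
  constructor
  · rintro ⟨f, hf⟩
    rw [hf, modByMonic_eq_sub_mul_div]
    exact dvd_sub (dvd_mul_left g f) (hg.mul_right _)
  · rintro ⟨f, hf⟩
    refine ⟨f, ?_⟩
    rw [mul_comm f g, ← hf, (modByMonic_eq_self_iff hmon).2]
    rw [← C_1, degree_X_pow_sub_C (NeZero.pos n)]
    exact degree_toPoly_lt c

theorem dvd_toPoly_shift_sub (c : Word n F) :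
    (X ^ n - 1 : F[X]) ∣ toPoly (fun i => c (i - 1)) - X * toPoly c := by
  have h : toPoly (fun i => c (i - 1)) = ∑ i : ZMod n, C (c i) * X ^ (i + 1).val := by
    rw [toPoly, ← Equiv.sum_comp (Equiv.addRight (1 : ZMod n))]
    simp
  rw [h, toPoly, Finset.mul_sum, ← Finset.sum_sub_distrib]
  refine Finset.dvd_sum fun i _ => ?_
  have hval : (i + 1).val = (i.val + 1) % n := by
    rw [← ZMod.val_natCast, Nat.cast_add, ZMod.natCast_zmod_val, Nat.cast_one]
  have key : (X : F[X]) ^ (i.val + 1) =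
      X ^ (i + 1).val * (X ^ n) ^ ((i.val + 1) / n) := by
    rw [hval, ← pow_mul, ← pow_add, Nat.mod_add_div]
  have : C (c i) * X ^ (i + 1).val - X * (C (c i) * X ^ i.val) =
      -(C (c i) * X ^ (i + 1).val) * (((X : F[X]) ^ n) ^ ((i.val + 1) / n) - 1) := by
    linear_combination (-C (c i)) * key
  rw [this]
  exact (sub_one_dvd_pow_sub_one _ _).mul_left _

theorem isCyclicCode_cyclicCode {g : F[X]} (hg : g ∣ X ^ n - 1) :
    IsCyclicCode (cyclicCode n g) := by
  intro c hc
  rw [mem_cyclicCode hg] at hc ⊢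
  exact (dvd_sub_left (hc.mul_left X)).1 (hg.trans (dvd_toPoly_shift_sub c))

/-- Multiplication by `g` identifies the polynomials of degree below `n - deg g` with the code. -/
theorem finrank_cyclicCode {g : F[X]} (hmon : g.Monic) (hg : g ∣ X ^ n - 1) :
    Module.finrank F (cyclicCode n g) = n - g.natDegree := by
  have hle : g.natDegree ≤ n := by
    have := natDegree_le_of_dvd hg (monic_X_pow_sub_C 1 (NeZero.ne n)).ne_zero
    rwa [← C_1, natDegree_X_pow_sub_C] at this
  have hdeg (f : F[X]) : (g * f).degree < n ↔ f.degree < (n - g.natDegree : ℕ) := by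
    rcases eq_or_ne f 0 with rfl | hf
    · simp
    · rw [← natDegree_lt_iff_degree_lt hf,
        ← natDegree_lt_iff_degree_lt (mul_ne_zero hmon.ne_zero hf),
        natDegree_mul hmon.ne_zero hf]
      omega
  let e : degreeLT F (n - g.natDegree) →ₗ[F] cyclicCode n g :=
    { toFun := fun f => ⟨fun i => (g * (f : F[X])).coeff i.val, by
        rw [mem_cyclicCode hg, toPoly_coeff ((hdeg _).2 (mem_degreeLT.1 f.2))]
        exact dvd_mul_right _ _⟩
      map_add' := fun f h => by ext i; simp [mul_add]
      map_smul' := fun r f => by ext i; simp }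
  have he (f) : toPoly (e f : Word n F) = g * (f : F[X]) :=
    toPoly_coeff ((hdeg _).2 (mem_degreeLT.1 f.2))
  have hbij : Function.Bijective e := by
    constructor
    · intro f h hfh
      have := he f
      rw [hfh, he h] at this
      exact Subtype.ext (mul_left_cancel₀ hmon.ne_zero this).symm
    · rintro ⟨c, hc⟩
      obtain ⟨f, hf⟩ := (mem_cyclicCode hg).1 hc
      refine ⟨⟨f, mem_degreeLT.2 ((hdeg f).1 (hf ▸ degree_toPoly_lt c))⟩, Subtype.ext ?_⟩
      exact toPoly_injective ((he _).trans hf.symm)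
  rw [← (LinearEquiv.ofBijective e hbij).finrank_eq, (degreeLTEquiv F _).finrank_eq,
    Module.finrank_fin_fun]

/-- A root `a` of multiplicity `m` yields `m` weighted moment equations; ordinary derivatives are
replaced by powers of `X * d/dX`, so that the weights depend on the index only modulo the
characteristic. -/
theorem sum_eq_zero_of_pow_dvd_toPoly {a : F} {m : ℕ} {c : Word n F}
    (h : (X - C a) ^ m ∣ toPoly c) {k : ℕ} (hk : k < m) :
    ∑ i : ZMod n, c i * (i.val : F) ^ k * a ^ i.val = 0 := by
  induction k generalizing m c with
  | zero =>
    have := (dvd_pow_self (X - C a) (by omega : m ≠ 0)).trans h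
    rw [dvd_iff_isRoot, IsRoot, toPoly, eval_finsetSum] at this
    simpa using this
  | succ k ih =>
    obtain ⟨m, rfl⟩ : ∃ l, m = l + 1 := ⟨m - 1, by omega⟩
    -- `X * d/dX` lowers the multiplicity by one and multiplies each coefficient by its index.
    have hθ : X * derivative (toPoly c) = toPoly (fun i => c i * (i.val : F)) := by
      simp only [toPoly, derivative_sum, Finset.mul_sum]
      refine Finset.sum_congr rfl fun i _ => ?_
      rw [derivative_C_mul_X_pow]
      rcases Nat.eq_zero_or_pos i.val with h0 | h0
      · simp [h0]
      · rw [mul_left_comm, ← pow_succ', Nat.sub_add_cancel h0]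
    have hdvd : (X - C a) ^ m ∣ toPoly (fun i => c i * (i.val : F)) := by
      rw [← hθ]
      exact (pow_sub_one_dvd_derivative_of_pow_dvd h).mul_left X
    rw [← ih hdvd (by omega)]
    exact Finset.sum_congr rfl fun i _ => by ring

end Poly

/-! ### The pair distance of two words -/

section PairWeight
variable {n : ℕ} [NeZero n] {F : Type*} [Field F] [DecidableEq F]

theorem hammingDist_eq_card_support (x y : Word n F) :
    hammingDist x y = (Finset.univ.filter fun i => (x - y) i ≠ 0).card := by
  simp [hammingDist, sub_eq_zero]

theorem pairDist_eq_card (x y : Word n F) :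
    pairDist x y = (Finset.univ.filter fun i => (x - y) i ≠ 0 ∨ (x - y) (i + 1) ≠ 0).card := by
  simp only [pairDist, hammingDist, pairRead, Pi.sub_apply, ne_eq, sub_eq_zero, Prod.mk.injEq,
    not_and_or]

theorem pairDist_le_two_mul_hammingDist (x y : Word n F) :
    pairDist x y ≤ 2 * hammingDist x y := by
  rw [pairDist_eq_card, hammingDist_eq_card_support, Finset.filter_or, two_mul]
  refine (Finset.card_union_le _ _).trans (Nat.add_le_add_left ?_ _)
  refine Finset.card_le_card_of_injOn (· + 1) (fun i hi => ?_) (add_left_injective 1).injOn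
  simpa using hi

end PairWeight

/-! ### Moments over the residue classes modulo three -/

section Moments
variable {p : ℕ} [Fact p.Prime]

/-- The residue modulo `3` of an index in `ℤ/3p`. -/
def toZModThree (p : ℕ) : ZMod (3 * p) →+* ZMod 3 := ZMod.castHom (dvd_mul_right 3 p) (ZMod 3)

/-- The residue modulo `p` of an index in `ℤ/3p`, as an element of `𝔽_p`. -/
def toZModP (p : ℕ) : ZMod (3 * p) →+* ZMod p := ZMod.castHom (dvd_mul_left p 3) (ZMod p)

theorem eq_of_residues_eq (hp : p ≠ 3) {i j : ZMod (3 * p)}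
    (h3 : toZModThree p i = toZModThree p j) (hP : toZModP p i = toZModP p j) : i = j := by
  have hcop : Nat.Coprime 3 p :=
    (Nat.coprime_primes Nat.prime_three Fact.out).2 hp.symm
  let e := ZMod.chineseRemainder hcop
  have h1 : toZModThree p = (RingHom.fst _ _).comp e.toRingHom := Subsingleton.elim _ _
  have h2 : toZModP p = (RingHom.snd _ _).comp e.toRingHom := Subsingleton.elim _ _
  rw [h1] at h3
  rw [h2] at hP
  exact e.injective (Prod.ext h3 hP)

/-- The part of the support of `c` lying in the residue class `r` modulo `3`. -/
def classSupport (c : Word (3 * p) (ZMod p)) (r : ZMod 3) : Finset (ZMod (3 * p)) :=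
  Finset.univ.filter fun i => c i ≠ 0 ∧ toZModThree p i = r

/-- The `k`-th power moment `∑ cᵢ iᵏ` of `c` over the indices `i` in the class `r` modulo `3`, with
`i` read in `𝔽_p` and `0 ^ 0 = 1`. -/
def moment (c : Word (3 * p) (ZMod p)) (r : ZMod 3) (k : ℕ) : ZMod p :=
  ∑ i ∈ classSupport c r, c i * toZModP p i ^ k

theorem three_ne_zero_of_ne (hp : p ≠ 3) : (3 : ZMod p) ≠ 0 := by
  intro h
  have : p ∣ 3 := (ZMod.natCast_eq_zero_iff 3 p).1 (by exact_mod_cast h)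
  exact hp ((Nat.prime_dvd_prime_iff_eq Fact.out Nat.prime_three).1 this)

theorem mem_classSupport {c : Word (3 * p) (ZMod p)} {r : ZMod 3} {i : ZMod (3 * p)} :
    i ∈ classSupport c r ↔ c i ≠ 0 ∧ toZModThree p i = r := by
  simp [classSupport]

/-- A sum over `ℤ/3` with the starting point `r` chosen freely; this makes the later arguments
invariant under cyclic shifts. -/
theorem sum_zmod_three {M : Type*} [AddCommMonoid M] (f : ZMod 3 → M) (r : ZMod 3) :
    ∑ s, f s = f r + f (r + 1) + f (r + 2) := by
  rw [← Equiv.sum_comp (Equiv.addLeft r)]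
  refine (Fin.sum_univ_three _).trans ?_
  change f (r + 0) + f (r + 1) + f (r + 2) = _
  rw [add_zero]

theorem pow_val_eq {a : ZMod p} (ha : a ^ 3 = 1) (i : ZMod (3 * p)) :
    a ^ i.val = a ^ (toZModThree p i).val := by
  rw [toZModThree, ZMod.castHom_apply, ZMod.cast_eq_val, ZMod.val_natCast, ← pow_mod_orderOf,
    ← pow_mod_orderOf a (i.val % 3), Nat.mod_mod_of_dvd _ (orderOf_dvd_of_pow_eq_one ha)]

theorem sum_pow_mul_moment {c : Word (3 * p) (ZMod p)} {a : ZMod p} (ha : a ^ 3 = 1) {m : ℕ}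
    (h : (X - C a) ^ m ∣ toPoly c) {k : ℕ} (hk : k < m) :
    moment c 0 k + a * moment c 1 k + a ^ 2 * moment c 2 k = 0 := by
  have hsum : ∑ r : ZMod 3, a ^ r.val * moment c r k = 0 := by
    rw [← sum_eq_zero_of_pow_dvd_toPoly h hk, ← Finset.sum_fiberwise _ (toZModThree p)]
    refine Finset.sum_congr rfl fun r _ => ?_
    rw [moment, Finset.mul_sum]
    refine Finset.sum_subset_zero_on_sdiff (fun i hi => ?_) (fun i hi => ?_) (fun i hi => ?_)
    · simpa using (mem_classSupport.1 hi).2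
    · simp only [Finset.mem_sdiff, Finset.mem_filter, Finset.mem_univ, true_and,
        mem_classSupport, not_and'] at hi
      simp [not_not.1 (hi.2 hi.1)]
    · rw [pow_val_eq ha, (mem_classSupport.1 hi).2, toZModP, ZMod.castHom_apply, ZMod.natCast_val]
      ring
  rw [sum_zmod_three _ 0] at hsum
  simpa [ZMod.val_one, show (2 : ZMod 3).val = 2 from rfl] using hsum

theorem moment_eq_zero_of_dvd {ω : ZMod p} (hω : IsPrimitiveRoot ω 3) {m : ℕ}
    (hp : p ≠ 3) {c : Word (3 * p) (ZMod p)}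
    (h0 : (X - C 1) ^ m ∣ toPoly c) (h1 : (X - C ω) ^ m ∣ toPoly c)
    (h2 : (X - C (ω ^ 2)) ^ m ∣ toPoly c) {k : ℕ} (hk : k < m) (r : ZMod 3) :
    moment c r k = 0 := by
  have e0 := sum_pow_mul_moment (one_pow 3) h0 hk
  have e1 := sum_pow_mul_moment hω.pow_eq_one h1 hk
  have e2 := sum_pow_mul_moment (by rw [← pow_mul, mul_comm, pow_mul, hω.pow_eq_one, one_pow]) h2 hk
  have hω3 := hω.pow_eq_one
  have hsum : 1 + ω + ω ^ 2 = 0 := by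
    simpa [Finset.sum_range_succ] using hω.geom_sum_eq_zero (by norm_num)
  refine (mul_eq_zero.1 ?_).resolve_left (three_ne_zero_of_ne hp)
  set u := moment c 0 k
  set v := moment c 1 k
  set w := moment c 2 k
  fin_cases r
  · change 3 * u = 0
    linear_combination e0 + e1 + e2 - (v + w) * hsum - (ω * w) * hω3
  · change 3 * v = 0
    linear_combination e0 + ω ^ 2 * e1 + ω * e2 - (u + w) * hsum - (2 * v + (ω + ω ^ 2) * w) * hω3
  · change 3 * w = 0
    linear_combination e0 + ω * e1 + ω ^ 2 * e2 - (u + v) * hsum - (2 * w + ω * v + (ω^3) * w) * hω3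

end Moments

/-! ### The lower bound for the pair weight -/

section LowerBound
variable {p : ℕ} [Fact p.Prime] {c : Word (3 * p) (ZMod p)}

theorem lt_card_classSupport (hp : p ≠ 3) {r : ZMod 3} (hr : (classSupport c r).Nonempty) {m : ℕ}
    (hm : ∀ k < m, moment c r k = 0) : m < (classSupport c r).card := by
  refine lt_card_of_moments_eq_zero (x := toZModP p) (c := c) (fun i hi j hj h => ?_)
    (fun i hi => (mem_classSupport.1 hi).1) hr hm
  exact eq_of_residues_eq hp
    ((mem_classSupport.1 hi).2.trans (mem_classSupport.1 hj).2.symm) h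

/-- If `c` meets only the classes `r` and `r + 1`, each in three points, then its support does not
consist of three pairs of adjacent indices. -/
theorem classSupport_ne_shift (hp : p ≠ 3) (h2 : ∀ r, ∀ k < 2, moment c r k = 0)
    (h4 : ∀ k < 4, ∑ r, moment c r k = 0) {r : ZMod 3}
    (hempty : classSupport c (r + 2) = ∅) (hcard : (classSupport c r).card = 3) :
    classSupport c (r + 1) ≠ (classSupport c r).image (· + 1) := by
  intro himg
  have hcard' : (classSupport c (r + 1)).card = 3 := by
    rw [himg, Finset.card_image_of_injective _ (add_left_injective 1), hcard]
  have e := sum_mul_pow_three_of_card_eq_three (x := toZModP p) (c := c) hcard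
    (h2 r 0 (by norm_num)) (h2 r 1 (by norm_num))
  have e' := sum_mul_pow_three_of_card_eq_three (x := toZModP p) (c := c) hcard'
    (h2 (r + 1) 0 (by norm_num)) (h2 (r + 1) 1 (by norm_num))
  have hx : ∑ i ∈ classSupport c (r + 1), toZModP p i =
      ∑ i ∈ classSupport c r, toZModP p i + 3 := by
    rw [himg, Finset.sum_image (add_left_injective 1).injOn]
    simp only [map_add, map_one, Finset.sum_add_distrib, Finset.sum_const, hcard]
    norm_num
  have hz (k) : moment c (r + 2) k = 0 := by rw [moment, hempty, Finset.sum_empty]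
  have s2 := h4 2 (by norm_num)
  have s3 := h4 3 (by norm_num)
  rw [sum_zmod_three _ r, hz, add_zero] at s2 s3
  change moment c r 3 = _ * moment c r 2 at e
  change moment c (r + 1) 3 = _ * moment c (r + 1) 2 at e'
  rw [hx] at e'
  have hm : moment c r 2 = 0 := by
    refine (mul_eq_zero.1 ?_).resolve_left (three_ne_zero_of_ne hp)
    linear_combination (∑ i ∈ classSupport c r, toZModP p i + 3) * s2 - s3 + e + e'
  have := lt_card_classSupport (c := c) hp (r := r) (m := 3)
    (Finset.card_pos.1 (by omega)) (fun k hk => by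
      interval_cases k
      · exact h2 r 0 (by norm_num)
      · exact h2 r 1 (by norm_num)
      · exact hm)
  omega

/-- The set in the conclusion is `T = S ∪ (S - 1)` for the support `S` of `c`, so its size is the pair
weight of `c`. -/
theorem ten_le_card_of_moments (hp : 3 < p) (h2 : ∀ r, ∀ k < 2, moment c r k = 0)
    (h4 : ∀ k < 4, ∑ r, moment c r k = 0) (hc : c ≠ 0) :
    10 ≤ (Finset.univ.filter fun i => c i ≠ 0 ∨ c (i + 1) ≠ 0).card := by
  classical
  set T := Finset.univ.filter fun i => c i ≠ 0 ∨ c (i + 1) ≠ 0 with hT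
  let t (r : ZMod 3) := T.filter fun i => toZModThree p i = r
  have hTcard (r : ZMod 3) : T.card = (t r).card + (t (r + 1)).card + (t (r + 2)).card := by
    rw [Finset.card_eq_sum_card_fiberwise (f := toZModThree p) (t := Finset.univ) (by simp),
      sum_zmod_three _ r]
  have hcov (r : ZMod 3) : classSupport c r ⊆ t r := by
    intro i hi
    rw [mem_classSupport] at hi
    simp [t, hT, hi.1, hi.2]
  have hle (r : ZMod 3) : (classSupport c r).card ≤ (t r).card := Finset.card_le_card (hcov r)
  have hprev (r : ZMod 3) {i} (hi : i ∈ classSupport c (r + 1)) : i - 1 ∈ t r := by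
    rw [mem_classSupport] at hi
    simp only [t, hT, Finset.mem_filter, Finset.mem_univ, true_and, sub_add_cancel]
    refine ⟨Or.inr hi.1, ?_⟩
    rw [map_sub, hi.2, map_one, add_sub_cancel_right]
  have hle' (r : ZMod 3) : (classSupport c (r + 1)).card ≤ (t r).card :=
    Finset.card_le_card_of_injOn (· - 1) (fun i hi => hprev r hi) (sub_left_injective).injOn
  have hthree (r) (hr : (classSupport c r).Nonempty) : 3 ≤ (classSupport c r).card :=
    lt_card_classSupport hp.ne' hr (h2 r)
  -- `r + 2` is the class preceding `r`.
  have hwrap (r : ZMod 3) : r + 2 + 1 = r := by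
    rw [add_assoc, show (2 + 1 : ZMod 3) = 0 from rfl, add_zero]
  have one (r : ZMod 3) (hr : (classSupport c r).Nonempty) (h1 : classSupport c (r + 1) = ∅)
      (h2' : classSupport c (r + 2) = ∅) : 10 ≤ T.card := by
    have h5 : 4 < (classSupport c r).card := by
      refine lt_card_classSupport hp.ne' hr fun k hk => ?_
      have := h4 k hk
      rw [sum_zmod_three _ r] at this
      simpa [moment, h1, h2'] using this
    have := hle r
    have := hle' (r + 2)
    rw [hwrap] at this
    have := hTcard r
    omega
  have two (r : ZMod 3) (hr : (classSupport c r).Nonempty) (h1 : (classSupport c (r + 1)).Nonempty)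
      (h2' : classSupport c (r + 2) = ∅) : 10 ≤ T.card := by
    by_contra! hlt
    have a1 := hle r
    have a2 := hle (r + 1)
    have a3 := hle' (r + 2)
    rw [hwrap] at a3
    have a4 := hTcard r
    have a5 := hthree _ hr
    have a6 := hthree _ h1
    have hSt : classSupport c r = t r := Finset.eq_of_subset_of_card_le (hcov r) (by omega)
    refine classSupport_ne_shift hp.ne' h2 h4 h2' (by omega)
      (Finset.eq_of_subset_of_card_le (fun i hi => ?_) ?_)
    · rw [Finset.mem_image, hSt]
      exact ⟨i - 1, hprev r hi, sub_add_cancel i 1⟩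
    · rw [Finset.card_image_of_injective _ (add_left_injective 1)]
      omega
  have three (h : ∀ r, (classSupport c r).Nonempty) : 10 ≤ T.card := by
    by_contra! hlt
    -- With `|T| ≤ 9` each class part of `T` equals that of `S`, so `S` is closed under predecessors.
    have hcl (i) (hi : c (i + 1) ≠ 0) : c i ≠ 0 := by
      set r := toZModThree p i with hr
      have a0 := hTcard r
      have a1 := hthree r (h r)
      have a2 := hthree (r + 1) (h (r + 1))
      have a3 := hthree (r + 2) (h (r + 2))
      have a4 := hle r
      have a5 := hle (r + 1)
      have a6 := hle (r + 2)
      have hSt : classSupport c r = t r := Finset.eq_of_subset_of_card_le (hcov r) (by omega)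
      have : i ∈ t r := by
        have := hprev r (i := i + 1) (mem_classSupport.2 ⟨hi, by rw [map_add, map_one]⟩)
        rwa [add_sub_cancel_right] at this
      rw [← hSt] at this
      exact (mem_classSupport.1 this).1
    obtain ⟨i, hi⟩ := Function.ne_iff.1 hc
    have hall (k : ℕ) : c (i - k) ≠ 0 := by
      induction k with
      | zero => simpa using hi
      | succ k ih => exact hcl _ (by rwa [Nat.cast_succ, ← sub_sub, sub_add_cancel])
    have huniv : T = Finset.univ := by
      rw [hT, Finset.filter_true_of_mem]
      intro j _
      left
      have := hall (i - j).val
      rwa [ZMod.natCast_zmod_val, sub_sub_cancel] at this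
    rw [huniv, Finset.card_univ, ZMod.card] at hlt
    omega
  rcases (classSupport c 0).eq_empty_or_nonempty with e0 | e0 <;>
  rcases (classSupport c 1).eq_empty_or_nonempty with e1 | e1 <;>
  rcases (classSupport c 2).eq_empty_or_nonempty with e2 | e2
  · obtain ⟨i, hi⟩ := Function.ne_iff.1 hc
    have hi' : i ∈ classSupport c (toZModThree p i) := mem_classSupport.2 ⟨hi, rfl⟩
    have hall : ∀ r, classSupport c r = ∅ := by
      intro r
      fin_cases r
      exacts [e0, e1, e2]
    simp [hall] at hi'
  · exact one 2 e2 e0 e1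
  · exact one 1 e1 e2 e0
  · exact two 1 e1 e2 e0
  · exact one 0 e0 e1 e2
  · exact two 2 e2 e0 e1
  · exact two 0 e0 e1 e2
  · refine three fun r => ?_
    fin_cases r
    exacts [e0, e1, e2]

end LowerBound

/-! ### The code generated by `(x - 1)⁴ (x - ω)² (x - ω²)²` -/

section Code
variable {p : ℕ} [Fact p.Prime]

theorem X_pow_three_sub_one_eq {F : Type*} [Field F] {ω : F} (hω : IsPrimitiveRoot ω 3) :
    (X ^ 3 - 1 : F[X]) = (X - C 1) * (X - C ω) * (X - C (ω ^ 2)) := by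
  have hsum : C (1 + ω + ω ^ 2) = (0 : F[X]) := by
    rw [← C_0]
    congr 1
    simpa [Finset.sum_range_succ] using hω.geom_sum_eq_zero (by norm_num)
  have h3 : (C ω : F[X]) ^ 3 = 1 := by rw [← C_pow, hω.pow_eq_one, C_1]
  simp only [C_add, C_1, C_pow] at hsum ⊢
  linear_combination (X ^ 2 - C ω * X) * hsum + h3

/-- In characteristic `p`, `x ^ (3p) - 1` is the `p`-th power of `x³ - 1`. -/
theorem X_pow_three_sub_one_pow_dvd (hp : 4 ≤ p) :
    ((X ^ 3 - 1) ^ 4 : (ZMod p)[X]) ∣ X ^ (3 * p) - 1 := by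
  have : (X ^ (3 * p) - 1 : (ZMod p)[X]) = (X ^ 3 - 1) ^ p := by
    rw [sub_pow_char, one_pow, pow_mul]
  rw [this]
  exact pow_dvd_pow _ hp

theorem ten_le_pairDist {ω : ZMod p} (hω : IsPrimitiveRoot ω 3) (hp : 3 < p)
    {x y : Word (3 * p) (ZMod p)} (hne : x ≠ y)
    (hdvd : (X - C 1) ^ 4 * (X - C ω) ^ 2 * (X - C (ω ^ 2)) ^ 2 ∣ toPoly (x - y)) :
    10 ≤ pairDist x y := by
  rw [pairDist_eq_card]
  have d0 : (X - C 1) ^ 4 ∣ toPoly (x - y) :=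
    ((dvd_mul_right _ _).trans (dvd_mul_right _ _)).trans hdvd
  have d1 : (X - C ω) ^ 2 ∣ toPoly (x - y) :=
    ((dvd_mul_left _ _).trans (dvd_mul_right _ _)).trans hdvd
  have d2 : (X - C (ω ^ 2)) ^ 2 ∣ toPoly (x - y) := (dvd_mul_left _ _).trans hdvd
  refine ten_le_card_of_moments hp (fun r k hk => ?_) (fun k hk => ?_) (sub_ne_zero.2 hne)
  · exact moment_eq_zero_of_dvd hω hp.ne' ((pow_dvd_pow _ (by norm_num)).trans d0) d1 d2 hk r
  · simpa [sum_zmod_three _ 0] using sum_pow_mul_moment (one_pow 3) d0 hk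

/-- The witness is `(x³ - 1)⁴`, which is supported on `0, 3, 6, 9, 12`. -/
theorem exists_mem_hammingDist_zero_le {g : (ZMod p)[X]} (hp : 4 < p)
    (hg : g ∣ (X ^ 3 - 1) ^ 4) :
    ∃ c ∈ cyclicCode (3 * p) g, c ≠ 0 ∧ hammingDist c 0 ≤ 5 := by
  set P : (ZMod p)[X] := (X ^ 3 - 1) ^ 4 with hP
  have hdeg : P.degree < (3 * p : ℕ) := by
    refine degree_le_natDegree.trans_lt (Nat.cast_lt.2 ?_)
    rw [hP, natDegree_pow, ← C_1, natDegree_X_pow_sub_C]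
    omega
  have hexp : P = C 1 * X ^ 12 + C (-4) * X ^ 9 + C 6 * X ^ 6 + C (-4) * X ^ 3 + C 1 * X ^ 0 := by
    simp only [hP, map_neg, map_ofNat, C_1]
    ring
  have hc := toPoly_coeff (n := 3 * p) hdeg
  refine ⟨fun i => P.coeff i.val, ?_, fun h0 => ?_, ?_⟩
  · rw [mem_cyclicCode (hg.trans (X_pow_three_sub_one_pow_dvd (by omega))), hc]
    exact hg
  · rw [h0] at hc
    have hmon : P.Monic := (monic_X_pow_sub_C (1 : ZMod p) (by norm_num : 3 ≠ 0)).pow 4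
    exact hmon.ne_zero (by simpa [toPoly] using hc.symm)
  · rw [hammingDist_eq_card_support]
    have hsub : (Finset.univ.filter fun i : ZMod (3 * p) =>
        ((fun i : ZMod (3 * p) => P.coeff i.val) - 0 : Word (3 * p) (ZMod p)) i ≠ 0).card ≤
        ({12, 9, 6, 3, 0} : Finset ℕ).card := by
      refine Finset.card_le_card_of_injOn ZMod.val (fun i hi => ?_) (ZMod.val_injective _).injOn
      simp only [Finset.coe_filter, Finset.mem_univ, true_and, Set.mem_ofPred_eq, Pi.sub_apply,
        Pi.zero_apply, sub_zero, hexp, coeff_add, coeff_C_mul_X_pow] at hi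
      by_contra hmem
      simp only [Finset.coe_insert, Finset.coe_singleton, Set.mem_insert_iff,
        Set.mem_singleton_iff, not_or] at hmem
      simp [hmem] at hi
    exact hsub

end Code

end SymbolPair

theorem theorem3p1 (p : ℕ) [Fact p.Prime] (hodd : Odd p) (h3 : 3 ∣ p - 1) :
    (∀ ω : ZMod p, IsPrimitiveRoot ω 3 →
      ∃ D : Submodule (ZMod p) (SymbolPair.Word (3 * p) (ZMod p)),
        SymbolPair.IsGeneratorPolynomial
          ((X - C 1) ^ 4 * (X - C ω) ^ 2 * (X - C (ω ^ 2)) ^ 2 : (ZMod p)[X]) D ∧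
        SymbolPair.IsLinearCode D (3 * p - 8) 5 ∧
        SymbolPair.HasMinPairDist (D : Set (SymbolPair.Word (3 * p) (ZMod p))) 10 ∧
        SymbolPair.IsMDSPairCode (D : Set (SymbolPair.Word (3 * p) (ZMod p))) 10) ∧
    ∃ E : Set (SymbolPair.Word (3 * p) (ZMod p)), SymbolPair.IsMDSPairCode E 10 := by
  have hp2 := (Fact.out : p.Prime).two_le
  -- `3 ∣ p - 1` rules out `p = 3`, the only odd prime up to `4`.
  have hp : 4 < p := by
    obtain ⟨k, hk⟩ := hodd
    omega
  have main : ∀ ω : ZMod p, IsPrimitiveRoot ω 3 →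
      ∃ D : Submodule (ZMod p) (SymbolPair.Word (3 * p) (ZMod p)),
        SymbolPair.IsGeneratorPolynomial
          ((X - C 1) ^ 4 * (X - C ω) ^ 2 * (X - C (ω ^ 2)) ^ 2 : (ZMod p)[X]) D ∧
        SymbolPair.IsLinearCode D (3 * p - 8) 5 ∧
        SymbolPair.HasMinPairDist (D : Set (SymbolPair.Word (3 * p) (ZMod p))) 10 ∧
        SymbolPair.IsMDSPairCode (D : Set (SymbolPair.Word (3 * p) (ZMod p))) 10 := by
    intro ω hω
    set g : (ZMod p)[X] := (X - C 1) ^ 4 * (X - C ω) ^ 2 * (X - C (ω ^ 2)) ^ 2 with hg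
    have hmon : g.Monic :=
      (((monic_X_sub_C _).pow 4).mul ((monic_X_sub_C _).pow 2)).mul ((monic_X_sub_C _).pow 2)
    have hdeg : g.natDegree = 8 := by
      rw [hg, (((monic_X_sub_C _).pow 4).mul ((monic_X_sub_C _).pow 2)).natDegree_mul
        ((monic_X_sub_C _).pow 2), ((monic_X_sub_C _).pow 4).natDegree_mul
        ((monic_X_sub_C _).pow 2)]
      simp only [natDegree_pow, natDegree_X_sub_C]
    have hdvd4 : g ∣ (X ^ 3 - 1) ^ 4 := by
      rw [SymbolPair.X_pow_three_sub_one_eq hω]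
      exact ⟨(X - C ω) ^ 2 * (X - C (ω ^ 2)) ^ 2, by rw [hg]; ring⟩
    have hdvd : g ∣ X ^ (3 * p) - 1 :=
      hdvd4.trans (SymbolPair.X_pow_three_sub_one_pow_dvd (by omega))
    set D := SymbolPair.cyclicCode (3 * p) g with hD
    have hlow : ∀ x ∈ D, ∀ y ∈ D, x ≠ y → 10 ≤ SymbolPair.pairDist x y :=
      fun x hx y hy hne => SymbolPair.ten_le_pairDist hω (by omega) hne
        ((SymbolPair.mem_cyclicCode hdvd).1 (D.sub_mem hx hy))
    obtain ⟨c, hcD, hc0, hc5⟩ :=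
      SymbolPair.exists_mem_hammingDist_zero_le hp hdvd4
    have hlow5 : ∀ x ∈ D, ∀ y ∈ D, x ≠ y → 5 ≤ hammingDist x y := fun x hx y hy hne => by
      have := hlow x hx y hy hne
      have := SymbolPair.pairDist_le_two_mul_hammingDist x y
      omega
    have hfin : Module.finrank (ZMod p) D = 3 * p - 8 := by
      rw [hD, SymbolPair.finrank_cyclicCode hmon hdvd, hdeg]
    have hham : SymbolPair.HasMinHammingDist (D : Set (SymbolPair.Word (3 * p) (ZMod p))) 5 := by
      refine ⟨⟨c, hcD, 0, D.zero_mem, hc0, ?_⟩, ?_⟩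
      · exact (hlow5 c hcD 0 D.zero_mem hc0).antisymm hc5
      · rintro m ⟨x, hx, y, hy, hne, rfl⟩
        exact hlow5 x hx y hy hne
    have hpair : SymbolPair.HasMinPairDist (D : Set (SymbolPair.Word (3 * p) (ZMod p))) 10 := by
      refine ⟨⟨c, hcD, 0, D.zero_mem, hc0, ?_⟩, ?_⟩
      · have := SymbolPair.pairDist_le_two_mul_hammingDist c 0
        exact (hlow c hcD 0 D.zero_mem hc0).antisymm (by omega)
      · rintro m ⟨x, hx, y, hy, hne, rfl⟩
        exact hlow x hx y hy hne
    refine ⟨D, ⟨SymbolPair.isCyclicCode_cyclicCode hdvd, hmon, hdvd, rfl⟩, ⟨hfin, hham⟩, hpair,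
      ⟨by norm_num, by omega, hpair, ?_⟩⟩
    rw [← Nat.card_coe_set_eq]
    refine (Module.natCard_eq_pow_finrank (K := ZMod p) (V := D)).trans ?_
    rw [hfin]
    congr 1
    omega
  refine ⟨main, ?_⟩
  -- A primitive cube root of unity is a power of a generator of the cyclic group `(ZMod p)ˣ`.
  obtain ⟨ζ, hζ⟩ := IsCyclic.exists_generator (α := (ZMod p)ˣ)
  have hζ' : IsPrimitiveRoot ζ (p - 1) := by
    rw [← ZMod.card_units p, ← Nat.card_eq_fintype_card, ← orderOf_eq_card_of_forall_mem_zpowers hζ]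
    exact IsPrimitiveRoot.orderOf ζ
  have hω := IsPrimitiveRoot.coe_units_iff.2 (hζ'.pow (b := 3) (a := (p - 1) / 3) (by omega)
    (Nat.div_mul_cancel h3).symm)
  obtain ⟨D, -, -, -, hD⟩ := main _ hω
  exact ⟨D, hD⟩
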